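/- Conventions. Fix a set of at least two attributes; each attribute $A$ has a domain $\mathrm{Dom}(A)$ with at least two elements. For a finite set $X$ of attributes, an $X$-tuple assigns to each $A\in X$ an element of $\mathrm{Dom}(A)$. Let $\mathbb K=(K,+,0)$ be a positive commutative monoid with at least two elements, where positive means that $p+q=0$ implies $p=q=0$. Write $a\sqsubseteq b$ if $a+c=b$ for some $c\in K$. A $\mathbb K$-relation $R(X)$ is a finitely supported function from the $X$-tuples to $K$. For $Y\subseteq X$, its marginal $R[Y]$ is given by $R[Y](t)=\sum_{r:\ r[Y]=t}R(r)$, where $r[Y]$ is the restriction of $r$ to $Y$. The preorder $\sqsubseteq$ is extended to $\mathbb K$-relations over the same set tuple by tuple. The relations $R(X)$ and $T(Y)$ are consistent if some $\mathbb K$-relation $W(X\cup Y)$ has $W[X]=R$ and $W[Y]=T$. The monoid $\mathbb K$ has the inner consistency property if all $R(X)$, $T(Y)$ with $R[X\cap Y]=T[X\cap Y]$ are consistent. A semijoin function $\mathcal S$ on $\mathbb K$ assigns to all $\mathbb K$-relations $R(X)$, $T(Y)$ a $\mathbb K$-relation $\mathcal S(R,T)$ over $X$ such that (P1) $\mathcal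 S(R,T)=R$ if $R$ and $T$ are consistent; (P2) $\mathcal S(R,T)\sqsubseteq R$; (P3) $\mathcal S(R,T)[X\cap Y]\sqsubseteq T[X\cap Y]$; (P4) if $T[X\cap Y]\sqsubseteq R[X\cap Y]$, then $\mathcal S(R,T)[X\cap Y]=T[X\cap Y]$. A hypergraph $H$ consists of a finite non-empty set of attributes (its nodes) and a set of non-empty subsets $X_1,\dots,X_m$ of it (its hyperedges). It is acyclic ($\alpha$-acyclic) if repeatedly deleting nodes that lie in exactly one hyperedge, and hyperedges that are contained in another hyperedge, can remove all nodes from all hyperedges. A semijoin program on $H$ is a finite sequence of assignments $X_i:=X_i\ltimes X_j$ with $1\le i,j\le m$. Given $\mathcal S$, it acts on collections $R_1(X_1),\dots,R_m(X_m)$ of $\mathbb K$-relations by performing the assignments $R_i:=\mathcal S(R_i,R_j)$ in order. The pair $(\pi,\mathcal S)$ is a full reducer for $H$ if, for every collection, the resulting collection $R_1^*,\dots,R_m^*$ is globally consistent, i.e. some $\mathbb K$-relation $W(X_1\cup\dots\cup X_m)$ has $W[X_i]=R_i^*$ for all $i$. Finally, $H$ has a full reducer on $\mathbb K$ if $(\pi,\mathcal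 S)$ is a full reducer for $H$ for some semijoin program $\pi$ on $H$ and some semijoin function $\mathcal S$ on $\mathbb K$. Theorem. To every hypergraph $H$ one can assign a semijoin program $\pi_H$ on $H$ that depends only on $H$ (and not on the domains or on the monoid) such that, for every positive commutative monoid $\mathbb K$ with at least two elements that has the inner consistency property and for every hypergraph $H$, the following are equivalent: (1) $H$ is acyclic; (2) for every semijoin function $\mathcal S$ on $\mathbb K$, the pair $(\pi_H,\mathcal S)$ is a full reducer for $H$; (2') there is a semijoin program $\pi$ on $H$ such that, for every semijoin function $\mathcal S$ on $\mathbb K$, the pair $(\pi,\mathcal S)$ is a full reducer for $H$; (3) $H$ has a full reducer on $\mathbb K$. -/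

import Mathlib

universe u v w

/-! ### Positive commutative monoids -/

/-- A commutative monoid `(K, +, 0)` is positive if `p + q = 0` forces `p = 0` and `q = 0`. -/
def IsPositiveMonoid (K : Type w) [AddCommMonoid K] : Prop :=
  ∀ p q : K, p + q = 0 → p = 0 ∧ q = 0

/-- The canonical preorder of a commutative monoid: `a ⊑ b` iff `a + c = b` for some `c`. -/
def CanonLE {K : Type w} [AddCommMonoid K] (a b : K) : Prop :=
  ∃ c : K, a + c = b

/-! ### Tuples, annotated relations and marginals

`Attr` is the type of attributes, `Dom A` is the domain of the attribute `A`. -/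

/-- The `X`-tuples, for a finite set `X` of attributes. -/
abbrev Tup {Attr : Type u} (Dom : Attr → Type v) (X : Finset Attr) : Type (max u v) :=
  ∀ A : X, Dom A

/-- (Finitely supported) `K`-relations over `X`. -/
abbrev KRel {Attr : Type u} (K : Type w) [AddCommMonoid K] (Dom : Attr → Type v)
    (X : Finset Attr) : Type (max u v w) :=
  Tup Dom X →₀ K

/-- The projection (marginal) `R[Y]` of a `K`-relation `R` over `X`, for `Y ⊆ X`. -/
noncomputable def KRel.marginal {Attr : Type u} {K : Type w} [AddCommMonoid K]
    {Dom : Attr → Type v} {X Y : Finset Attr} (R : KRel K Dom X) (h : Y ⊆ X) : KRel K Dom Y :=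
  Finsupp.mapDomain (Finset.restrict₂ (π := Dom) h) R

open Classical in
/-- The marginal is the sum of the annotations of the tuples of the support that project to `t`. -/
theorem KRel.marginal_apply {Attr : Type u} {K : Type w} [AddCommMonoid K]
    {Dom : Attr → Type v} {X Y : Finset Attr} (R : KRel K Dom X) (h : Y ⊆ X) (t : Tup Dom Y) :
    R.marginal h t =
      ∑ r ∈ R.support.filter (fun r => Finset.restrict₂ (π := Dom) h r = t), R r := by
  simp only [KRel.marginal, Finsupp.mapDomain, Finsupp.sum, Finsupp.finsetSum_apply,
    Finsupp.single_apply, Finset.sum_filter]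

/-- The canonical preorder on `K`-relations over `X`, tuple by tuple. -/
def KRel.LE {Attr : Type u} {K : Type w} [AddCommMonoid K] {Dom : Attr → Type v}
    {X : Finset Attr} (R T : KRel K Dom X) : Prop :=
  ∀ t : Tup Dom X, CanonLE (R t) (T t)

/-- `R(X)` and `T(Y)` are consistent: some `W(X ∪ Y)` has `W[X] = R` and `W[Y] = T`. -/
def KRel.Consistent {Attr : Type u} [DecidableEq Attr] {K : Type w} [AddCommMonoid K]
    {Dom : Attr → Type v} {X Y : Finset Attr} (R : KRel K Dom X) (T : KRel K Dom Y) : Prop :=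
  ∃ W : KRel K Dom (X ∪ Y),
    W.marginal Finset.subset_union_left = R ∧ W.marginal Finset.subset_union_right = T

/-- `R(X)` and `T(Y)` are inner consistent: `R[X ∩ Y] = T[X ∩ Y]`. -/
def KRel.InnerConsistent {Attr : Type u} [DecidableEq Attr] {K : Type w} [AddCommMonoid K]
    {Dom : Attr → Type v} {X Y : Finset Attr} (R : KRel K Dom X) (T : KRel K Dom Y) : Prop :=
  R.marginal (Finset.inter_subset_left : X ∩ Y ⊆ X) =
    T.marginal (Finset.inter_subset_right : X ∩ Y ⊆ Y)

/-- The inner consistency property: inner consistent `K`-relations are consistent. -/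
def InnerConsistencyProperty {Attr : Type u} [DecidableEq Attr] (K : Type w) [AddCommMonoid K]
    (Dom : Attr → Type v) : Prop :=
  ∀ (X Y : Finset Attr) (R : KRel K Dom X) (T : KRel K Dom Y),
    R.InnerConsistent T → R.Consistent T

/-! ### Semijoin functions -/

/-- A semijoin function on `K`: a function taking `R(X)` and `T(Y)` to a `K`-relation over `X`,
with the four defining properties. -/
structure SemijoinFunction {Attr : Type u} [DecidableEq Attr] (K : Type w) [AddCommMonoid K]
    (Dom : Attr → Type v) where
  toFun : ∀ {X Y : Finset Attr}, KRel K Dom X → KRel K Dom Y → KRel K Dom X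
  p1 : ∀ {X Y : Finset Attr} (R : KRel K Dom X) (T : KRel K Dom Y),
    R.Consistent T → toFun R T = R
  p2 : ∀ {X Y : Finset Attr} (R : KRel K Dom X) (T : KRel K Dom Y), (toFun R T).LE R
  p3 : ∀ {X Y : Finset Attr} (R : KRel K Dom X) (T : KRel K Dom Y),
    ((toFun R T).marginal (Finset.inter_subset_left : X ∩ Y ⊆ X)).LE
      (T.marginal (Finset.inter_subset_right : X ∩ Y ⊆ Y))
  p4 : ∀ {X Y : Finset Attr} (R : KRel K Dom X) (T : KRel K Dom Y),
    (T.marginal (Finset.inter_subset_right : X ∩ Y ⊆ Y)).LE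
      (R.marginal (Finset.inter_subset_left : X ∩ Y ⊆ X)) →
    (toFun R T).marginal (Finset.inter_subset_left : X ∩ Y ⊆ X) =
      T.marginal (Finset.inter_subset_right : X ∩ Y ⊆ Y)

/-! ### Hypergraphs and acyclicity -/

/-- A hypergraph whose nodes are attributes: a finite non-empty set of nodes and a set of
non-empty subsets of it. -/
structure AttrHypergraph (Attr : Type u) where
  nodes : Finset Attr
  edges : Finset (Finset Attr)
  nodes_nonempty : nodes.Nonempty
  edge_subset : ∀ X ∈ edges, X ⊆ nodes
  edge_nonempty : ∀ X ∈ edges, X.Nonempty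

/-- One step of the Graham (Graham–Yu–Ozsoyoglu) reduction of a set of hyperedges: delete a
hyperedge that is contained in another hyperedge, or delete from the hyperedge `X` a node that
belongs to no hyperedge but `X`. -/
inductive GrahamStep {Attr : Type u} [DecidableEq Attr] (F : Finset (Finset Attr)) :
    Finset (Finset Attr) → Prop
  | removeEdge (X Y : Finset Attr) (hX : X ∈ F) (hY : Y ∈ F) (hne : X ≠ Y) (hXY : X ⊆ Y) :
      GrahamStep F (F.erase X)
  | removeNode (X : Finset Attr) (a : Attr) (hX : X ∈ F) (ha : a ∈ X)
      (huniq : ∀ Y ∈ F, a ∈ Y → Y = X) :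
      GrahamStep F (insert (X.erase a) (F.erase X))

/-- A hypergraph is acyclic (`α`-acyclic) if the Graham reduction can be carried on until no
node is left, i.e. until there is no hyperedge other than possibly the empty one. -/
def AttrHypergraph.Acyclic {Attr : Type u} [DecidableEq Attr] (H : AttrHypergraph Attr) : Prop :=
  ∃ F : Finset (Finset Attr), Relation.ReflTransGen GrahamStep H.edges F ∧ F ⊆ {∅}

/-! ### Semijoin programs and full reducers -/

/-- A semijoin program on `H`: a finite sequence of assignments `X := X ⋉ Y`, each given by the
pair `(X, Y)` of hyperedges. -/
abbrev SemijoinProgram {Attr : Type u} (H : AttrHypergraph Attr) : Type u :=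
  List (H.edges × H.edges)

/-- A collection of `K`-relations over `H`, one over every hyperedge. -/
abbrev KRelCollection {Attr : Type u} (K : Type w) [AddCommMonoid K] (Dom : Attr → Type v)
    (H : AttrHypergraph Attr) : Type (max u v w) :=
  ∀ X : H.edges, KRel K Dom X.1

/-- The collection resulting from the program `π` when `⋉` is interpreted by `S`. -/
noncomputable def SemijoinProgram.run {Attr : Type u} [DecidableEq Attr] {K : Type w}
    [AddCommMonoid K] {Dom : Attr → Type v} {H : AttrHypergraph Attr}
    (S : SemijoinFunction K Dom) :
    SemijoinProgram H → KRelCollection K Dom H → KRelCollection K Dom H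
  | [], R => R
  | (X, Y) :: π, R => SemijoinProgram.run S π (Function.update R X (S.toFun (R X) (R Y)))

/-- A collection of `K`-relations over `H` is globally consistent if it is the collection of the
marginals of one `K`-relation over the union of the hyperedges. -/
def KRelCollection.GloballyConsistent {Attr : Type u} [DecidableEq Attr] {K : Type w}
    [AddCommMonoid K] {Dom : Attr → Type v} {H : AttrHypergraph Attr}
    (R : KRelCollection K Dom H) : Prop :=
  ∃ W : KRel K Dom (H.edges.biUnion id),
    ∀ X : H.edges, W.marginal (Finset.subset_biUnion_of_mem id X.2) = R X

/-- The pair `(π, S)` is a full reducer for `H`. -/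
def IsFullReducer {Attr : Type u} [DecidableEq Attr] {K : Type w} [AddCommMonoid K]
    {Dom : Attr → Type v} {H : AttrHypergraph Attr} (π : SemijoinProgram H)
    (S : SemijoinFunction K Dom) : Prop :=
  ∀ R : KRelCollection K Dom H, (SemijoinProgram.run S π R).GloballyConsistent

/-- `H` has a full reducer on `K`. -/
def HasFullReducer {Attr : Type u} [DecidableEq Attr] (K : Type w) [AddCommMonoid K]
    (Dom : Attr → Type v) (H : AttrHypergraph Attr) : Prop :=
  ∃ (π : SemijoinProgram H) (S : SemijoinFunction K Dom), IsFullReducer π S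

/-! An acyclic hypergraph can be listed so that each edge X meets the union of the earlier ones
inside a single earlier edge P (`AttrHypergraph.Acyclic.hasRunningIntersection`). Its program is
built by recursion on this list: first P := P ⋉ X, then the program of the earlier edges, then X :=
X ⋉ P. The first assignment puts the marginal of P on X ∩ P below that of X, and P can only shrink
afterwards, so by (P4) the last one makes the two marginals equal; the inner consistency property
then glues X to the witness of the earlier edges. Only (P2)–(P4) are used, so the program serves
every monoid and every semijoin function. For some full reducer to exist there must also be a
semijoin function; it comes from Riesz decomposition, a consequence of inner consistency.

Conversely, (P1) makes any program fix a pairwise consistent collection, so a full reducer forces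
pairwise inner consistent collections to be globally consistent. Multiples of one element p ≠ 0
carry counterexamples over ℕ to K. A parity twist around a long chordless cycle, and a signed family
of subsets of a clique outside every edge, are such counterexamples. Hence the graph of H is chordal
and H is conformal; Dirac's simplicial vertices then drive the Graham reduction to the end
(`LocalToGlobal.acyclic`). -/

/-! ### Positive monoids and pushforwards of finitely supported functions. -/

section Monoid

variable {K : Type w} [AddCommMonoid K]

theorem CanonLE.refl (a : K) : CanonLE a a := ⟨0, add_zero a⟩

theorem CanonLE.zero_le (a : K) : CanonLE 0 a := ⟨a, zero_add a⟩

theorem CanonLE.add {a b c d : K} (h₁ : CanonLE a b) (h₂ : CanonLE c d) :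
    CanonLE (a + c) (b + d) := by
  obtain ⟨x, rfl⟩ := h₁
  obtain ⟨y, rfl⟩ := h₂
  exact ⟨x + y, add_add_add_comm a c x y⟩

theorem CanonLE.eq_zero (hK : IsPositiveMonoid K) {a : K} (h : CanonLE a 0) : a = 0 := by
  obtain ⟨c, hc⟩ := h
  exact (hK a c hc).1

theorem IsPositiveMonoid.nsmul_ne_zero (hK : IsPositiveMonoid K) {p : K} (hp : p ≠ 0) {n : ℕ}
    (hn : n ≠ 0) : n • p ≠ 0 := by
  obtain ⟨m, rfl⟩ := Nat.exists_eq_succ_of_ne_zero hn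
  intro h
  rw [Nat.succ_eq_add_one, succ_nsmul] at h
  exact hp (hK _ _ h).2

/-- The Riesz decomposition property of a commutative monoid. -/
def RieszDecomposition (K : Type w) [AddCommMonoid K] : Prop :=
  ∀ t a b : K, CanonLE t (a + b) → ∃ a' b' : K, t = a' + b' ∧ CanonLE a' a ∧ CanonLE b' b

/-- In a positive monoid, a pointwise canonical inequality of finitely supported functions has a
finitely supported complement. -/
theorem Finsupp.exists_add_eq_of_canonLE (hK : IsPositiveMonoid K) {α : Type*} {f g : α →₀ K}
    (h : ∀ x, CanonLE (f x) (g x)) : ∃ c, f + c = g := by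
  classical
  choose c hc using h
  -- Where `g` vanishes, positivity forces `f` to vanish, so 0 is a complement there and the support
  -- stays finite.
  refine ⟨Finsupp.onFinset g.support (fun x => if g x = 0 then 0 else c x) (by simp; tauto), ?_⟩
  ext x
  by_cases hx : g x = 0
  · have := hc x
    rw [hx] at this
    simp [hx, (hK _ _ this).1]
  · simp [hx, hc x]

theorem Finsupp.canonLE_of_add_eq {α : Type*} {f g c : α →₀ K} (h : f + c = g) (x : α) :
    CanonLE (f x) (g x) := ⟨c x, by rw [← h]; rfl⟩

theorem Finsupp.mapDomain_canonLE (hK : IsPositiveMonoid K) {α β : Type*} (φ : α → β)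
    {f g : α →₀ K} (h : ∀ x, CanonLE (f x) (g x)) (y : β) :
    CanonLE (f.mapDomain φ y) (g.mapDomain φ y) := by
  obtain ⟨c, rfl⟩ := Finsupp.exists_add_eq_of_canonLE hK h
  exact Finsupp.canonLE_of_add_eq (Finsupp.mapDomain_add (v₁ := f) (v₂ := c)).symm y

/-- In a positive monoid with Riesz decomposition, whatever lies below a marginal of `g` is a
marginal of something below `g`. -/
theorem Finsupp.exists_mapDomain_eq_of_canonLE (hK : IsPositiveMonoid K)
    (hR : RieszDecomposition K) {α β : Type*} (φ : α → β) (g : α →₀ K) :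
    ∀ f : β →₀ K, (∀ y, CanonLE (f y) (g.mapDomain φ y)) →
      ∃ g' : α →₀ K, (∀ x, CanonLE (g' x) (g x)) ∧ g'.mapDomain φ = f := by
  classical
  induction g using Finsupp.induction with
  | zero =>
    intro f hf
    refine ⟨0, fun x => CanonLE.refl _, ?_⟩
    ext y
    simpa using (CanonLE.eq_zero hK (by simpa using hf y)).symm
  | single_add x k g _ _ ih =>
    intro f hf
    simp only [Finsupp.mapDomain_add, Finsupp.mapDomain_single] at hf
    obtain ⟨a, b, hab, ha, hb⟩ := hR _ _ _ (by simpa using hf (φ x))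
    -- The point `x` supplies the part `a` of the mass over `φ x`; the rest of `g` has to supply
    -- `b`.
    obtain ⟨g', hg', hg'f⟩ := ih (f.update (φ x) b) (fun y => by
      by_cases hy : y = φ x
      · subst hy; simpa using hb
      · simpa [Function.update_of_ne hy, Finsupp.single_apply, Ne.symm hy] using hf y)
    refine ⟨Finsupp.single x a + g', fun z => ?_, ?_⟩
    · refine CanonLE.add ?_ (hg' z)
      by_cases hz : x = z
      · subst hz; simpa using ha
      · simpa [Finsupp.single_apply, hz] using CanonLE.refl (0 : K)
    · rw [Finsupp.mapDomain_add, hg'f, Finsupp.mapDomain_single]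
      ext y
      by_cases hy : y = φ x
      · subst hy; simp [hab]
      · simp [Function.update_of_ne hy, Ne.symm hy]

/-- A pushforward does not vanish at the image of a point of the support. -/
theorem Finsupp.mapDomain_ne_zero_of_ne_zero (hK : IsPositiveMonoid K) {α β : Type*} (φ : α → β)
    {f : α →₀ K} {x : α} (hx : f x ≠ 0) : f.mapDomain φ (φ x) ≠ 0 := by
  classical
  intro h
  rw [← f.single_add_erase x, Finsupp.mapDomain_add, Finsupp.mapDomain_single,
    Finsupp.add_apply, Finsupp.single_eq_same] at h
  exact hx (hK _ _ h).1

theorem Finsupp.exists_eq_sum_single_bool (M : Bool × Bool →₀ K) :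
    M = Finsupp.single (true, true) (M (true, true)) + Finsupp.single (true, false) (M (true, false))
      + Finsupp.single (false, true) (M (false, true))
      + Finsupp.single (false, false) (M (false, false)) := by
  ext ⟨a, b⟩
  cases a <;> cases b <;> simp

end Monoid

/-! ### Marginals, Riesz decomposition, existence of semijoin functions. -/

section Marginal

variable {Attr : Type u} {K : Type w} [AddCommMonoid K] {Dom : Attr → Type v}

theorem KRel.marginal_marginal {X Y Z : Finset Attr} (R : KRel K Dom X) (h₁ : Y ⊆ X)
    (h₂ : Z ⊆ Y) : (R.marginal h₁).marginal h₂ = R.marginal (h₂.trans h₁) := by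
  simp only [KRel.marginal, ← Finsupp.mapDomain_comp]
  rfl

theorem KRel.marginal_self {X : Finset Attr} (R : KRel K Dom X) (h : X ⊆ X) :
    R.marginal h = R := by
  have : Finset.restrict₂ (π := Dom) h = id := rfl
  rw [KRel.marginal, this, Finsupp.mapDomain_id]

theorem KRel.LE.refl {X : Finset Attr} (R : KRel K Dom X) : R.LE R := fun _ => CanonLE.refl _

theorem KRel.LE.trans {X : Finset Attr} {R S T : KRel K Dom X} (h₁ : R.LE S) (h₂ : S.LE T) :
    R.LE T := fun t => by
  obtain ⟨c, hc⟩ := h₁ t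
  obtain ⟨d, hd⟩ := h₂ t
  exact ⟨c + d, by rw [← add_assoc, hc, hd]⟩

theorem KRel.LE.marginal (hK : IsPositiveMonoid K) {X Y : Finset Attr} {R T : KRel K Dom X}
    (h : R.LE T) (hY : Y ⊆ X) : (R.marginal hY).LE (T.marginal hY) :=
  Finsupp.mapDomain_canonLE hK _ h

/-- If t + c = a + b, unary relations with values t, c and a, b over two different attributes have
equal total mass. A witness of their consistency is a 2 × 2 matrix with row sums t, c and column
sums a, b; its first row splits t. -/
theorem InnerConsistencyProperty.rieszDecomposition [DecidableEq Attr] [Nontrivial Attr]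
    [∀ A, Nontrivial (Dom A)] (h : InnerConsistencyProperty K Dom) : RieszDecomposition K := by
  classical
  rintro t a b ⟨c, hc⟩
  obtain ⟨A, B, hAB⟩ := exists_pair_ne Attr
  have key : ∀ C : Attr, ∃ x y : Tup Dom {C}, x ≠ y := fun C => by
    obtain ⟨x, y, hxy⟩ := exists_pair_ne (Dom C)
    have e : ∀ D : ({C} : Finset Attr), C = D := fun D => (Finset.mem_singleton.1 D.2).symm
    refine ⟨fun D => e D ▸ x, fun D => e D ▸ y, fun H => hxy ?_⟩
    simpa using congrFun H ⟨C, by simp⟩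
  obtain ⟨x₀, x₁, hx⟩ := key A
  obtain ⟨y₀, y₁, hy⟩ := key B
  have hempty : ({A} ∩ {B} : Finset Attr) = ∅ :=
    Finset.singleton_inter_of_notMem (by simpa using hAB)
  have hsub : Subsingleton (Tup Dom ({A} ∩ {B} : Finset Attr)) := by
    rw [hempty]; infer_instance
  obtain ⟨W, hW₁, hW₂⟩ := h {A} {B} (Finsupp.single x₀ t + Finsupp.single x₁ c)
    (Finsupp.single y₀ a + Finsupp.single y₁ b) (by
      simp only [KRel.InnerConsistent, KRel.marginal, Finsupp.mapDomain_add,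
        Finsupp.mapDomain_single]
      ext s
      rw [Subsingleton.elim (Finset.restrict₂ _ x₀) s, Subsingleton.elim (Finset.restrict₂ _ x₁) s,
        Subsingleton.elim (Finset.restrict₂ _ y₀) s, Subsingleton.elim (Finset.restrict₂ _ y₁) s]
      simp [hc])
  -- The domains may have further elements; merging all values other than the first gives a 2 × 2
  -- matrix without appeal to positivity.
  let φ : Tup Dom ({A} : Finset Attr) → Bool := fun x => decide (x = x₀)
  let ψ : Tup Dom ({B} : Finset Attr) → Bool := fun y => decide (y = y₀)
  let M : Bool × Bool →₀ K := W.mapDomain fun z =>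
    (φ (Finset.restrict₂ Finset.subset_union_left z), ψ (Finset.restrict₂ Finset.subset_union_right z))
  have h₁ : M.mapDomain Prod.fst = Finsupp.single true t + Finsupp.single false c := by
    have : M.mapDomain Prod.fst = (W.marginal Finset.subset_union_left).mapDomain φ := by
      simp only [M, KRel.marginal, ← Finsupp.mapDomain_comp]
      rfl
    rw [this, hW₁, Finsupp.mapDomain_add, Finsupp.mapDomain_single, Finsupp.mapDomain_single]
    simp [φ, hx.symm]
  have h₂ : M.mapDomain Prod.snd = Finsupp.single true a + Finsupp.single false b := by
    have : M.mapDomain Prod.snd = (W.marginal Finset.subset_union_right).mapDomain ψ := by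
      simp only [M, KRel.marginal, ← Finsupp.mapDomain_comp]
      rfl
    rw [this, hW₂, Finsupp.mapDomain_add, Finsupp.mapDomain_single, Finsupp.mapDomain_single]
    simp [ψ, hy.symm]
  rw [M.exists_eq_sum_single_bool] at h₁ h₂
  simp only [Finsupp.mapDomain_add, Finsupp.mapDomain_single] at h₁ h₂
  have e₁ := DFunLike.congr_fun h₁ true
  have e₂ := DFunLike.congr_fun h₂ true
  have e₃ := DFunLike.congr_fun h₂ false
  simp at e₁ e₂ e₃
  exact ⟨_, _, e₁.symm, ⟨_, e₂⟩, ⟨_, e₃⟩⟩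

open Classical in
/-- The semijoin function that leaves `R` unchanged if it is consistent with `T`, selects a part
of `R` with the marginal of `T` if there is one, and is zero otherwise. -/
theorem InnerConsistencyProperty.nonempty_semijoinFunction [DecidableEq Attr] [Nontrivial Attr]
    [∀ A, Nontrivial (Dom A)] (hK : IsPositiveMonoid K) (h : InnerConsistencyProperty K Dom) :
    Nonempty (SemijoinFunction K Dom) := by
  have key : ∀ (X Y : Finset Attr) (R : KRel K Dom X) (T : KRel K Dom Y), ∃ Q : KRel K Dom X,
      (R.Consistent T → Q = R) ∧ Q.LE R ∧
      (Q.marginal (Finset.inter_subset_left : X ∩ Y ⊆ X)).LE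
        (T.marginal (Finset.inter_subset_right : X ∩ Y ⊆ Y)) ∧
      ((T.marginal (Finset.inter_subset_right : X ∩ Y ⊆ Y)).LE
        (R.marginal (Finset.inter_subset_left : X ∩ Y ⊆ X)) →
        Q.marginal (Finset.inter_subset_left : X ∩ Y ⊆ X) =
          T.marginal (Finset.inter_subset_right : X ∩ Y ⊆ Y)) := by
    intro X Y R T
    by_cases hc : R.Consistent T
    · have hRT : R.marginal (Finset.inter_subset_left : X ∩ Y ⊆ X) =
          T.marginal (Finset.inter_subset_right : X ∩ Y ⊆ Y) := by
        obtain ⟨W, rfl, rfl⟩ := hc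
        simp only [KRel.marginal_marginal]
      exact ⟨R, fun _ => rfl, KRel.LE.refl R, hRT ▸ KRel.LE.refl _, fun _ => hRT⟩
    · by_cases hle : (T.marginal (Finset.inter_subset_right : X ∩ Y ⊆ Y)).LE
        (R.marginal (Finset.inter_subset_left : X ∩ Y ⊆ X))
      · obtain ⟨Q, hQ, hQT⟩ := Finsupp.exists_mapDomain_eq_of_canonLE hK h.rieszDecomposition
          (Finset.restrict₂ (π := Dom) (Finset.inter_subset_left : X ∩ Y ⊆ X)) R _ hle
        exact ⟨Q, fun h => absurd h hc, hQ, hQT ▸ KRel.LE.refl _, fun _ => hQT⟩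
      · refine ⟨0, fun h => absurd h hc, fun t => CanonLE.zero_le _, fun t => ?_,
          fun h => absurd h hle⟩
        simpa [KRel.marginal] using CanonLE.zero_le _
  choose S h1 h2 h3 h4 using key
  exact ⟨⟨fun R T => S _ _ R T, fun R T => h1 _ _ R T, fun R T => h2 _ _ R T,
    fun R T => h3 _ _ R T, fun R T => h4 _ _ R T⟩⟩

end Marginal

/-! ### From Graham reduction to running intersection. -/

section Reduction

variable {Attr : Type u} [DecidableEq Attr]

/-- A finite family of sets has the running intersection property if it can be listed so that
the intersection of each member with the union of the earlier ones lies in an earlier one. -/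
inductive HasRunningIntersection : Finset (Finset Attr) → Prop
  | nil : HasRunningIntersection ∅
  | single (X : Finset Attr) : HasRunningIntersection {X}
  | cons (F : Finset (Finset Attr)) (X P : Finset Attr) (hF : HasRunningIntersection F)
      (hX : X ∉ F) (hP : P ∈ F) (hXP : X ∩ F.biUnion id ⊆ P) :
      HasRunningIntersection (insert X F)

/-- Adding to the member `X` a node that lies in no member preserves the running intersection
property. -/
theorem HasRunningIntersection.replace {F : Finset (Finset Attr)}
    (h : HasRunningIntersection F) {X : Finset Attr} {a : Attr}
    (ha : ∀ Y ∈ F, a ∉ Y) :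
    HasRunningIntersection (F.image fun Y => if Y = X then insert a X else Y) := by
  set g : Finset Attr → Finset Attr := fun Y => if Y = X then insert a X else Y with hg
  have hsub : ∀ Y, Y ⊆ g Y := fun Y => by
    by_cases h : Y = X
    · subst h; simp [hg]
    · simp [hg, h]
  have hmem : ∀ Y b, b ∈ g Y → b = a ∨ b ∈ Y := fun Y b hb => by
    by_cases h : Y = X
    · subst h; simpa [hg] using hb
    · simp [hg, h] at hb; exact Or.inr hb
  induction h with
  | nil => simpa using HasRunningIntersection.nil
  | single Y => simpa using HasRunningIntersection.single _
  | cons F Y P hF hY hP hYP ih =>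
    have haF : ∀ Z ∈ F, a ∉ Z := fun Z hZ => ha Z (Finset.mem_insert_of_mem hZ)
    have haY : a ∉ Y := ha Y (Finset.mem_insert_self _ _)
    -- As `a` is a new node, the enlarged member cannot coincide with another one.
    have hinj : ∀ Z ∈ F, g Z ≠ g Y := by
      intro Z hZ h
      have hZY : Z ≠ Y := fun h => hY (h ▸ hZ)
      by_cases h1 : Z = X <;> by_cases h2 : Y = X
      · exact hZY (h1.trans h2.symm)
      · simp only [hg, h1, h2, if_true, if_false] at h
        exact haY (h ▸ Finset.mem_insert_self _ _)
      · simp only [hg, h1, h2, if_true, if_false] at h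
        exact haF Z hZ (h ▸ Finset.mem_insert_self _ _)
      · simp only [hg, h1, h2, if_false] at h
        exact hZY h
    rw [Finset.image_insert]
    refine HasRunningIntersection.cons _ _ (g P) (ih haF) ?_ (Finset.mem_image_of_mem _ hP) ?_
    · intro h
      obtain ⟨Z, hZ, hZY⟩ := Finset.mem_image.1 h
      exact hinj Z hZ hZY
    · intro b hb
      simp only [Finset.mem_inter, Finset.mem_biUnion, Finset.mem_image, id] at hb
      obtain ⟨hbY, _, ⟨Z, hZ, rfl⟩, hbZ⟩ := hb
      by_cases hba : b = a
      · subst hba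
        have e1 : Y = X := by
          by_contra h
          simp only [hg, h, if_false] at hbY
          exact haY hbY
        have e2 : Z = X := by
          by_contra h
          simp only [hg, h, if_false] at hbZ
          exact haF Z hZ hbZ
        exact absurd (e2.trans e1.symm ▸ hZ) hY
      · refine hsub P (hYP ?_)
        simp only [Finset.mem_inter, Finset.mem_biUnion, id]
        exact ⟨(hmem _ _ hbY).resolve_left hba, Z, hZ, (hmem _ _ hbZ).resolve_left hba⟩

/-- Each step can be undone: a deleted edge is appended with the edge containing it as parent, and a
deleted node is put back into its only edge. If `X.erase a` was an edge already, deleting the node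
amounts to deleting the edge X, whose parent is `X.erase a`. -/
theorem HasRunningIntersection.of_grahamStep {F F' : Finset (Finset Attr)}
    (hstep : GrahamStep F F') (h : HasRunningIntersection F') : HasRunningIntersection F := by
  cases hstep with
  | removeEdge X Y hX hY hne hXY =>
    rw [← Finset.insert_erase hX]
    exact .cons _ X Y h (by simp) (Finset.mem_erase.2 ⟨hne.symm, hY⟩)
      (Finset.inter_subset_left.trans hXY)
  | removeNode X a hX ha huniq =>
    have hne : X ≠ X.erase a := fun e => (Finset.notMem_erase a X) (e ▸ ha)
    by_cases hmem : X.erase a ∈ F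
    · rw [Finset.insert_eq_of_mem (Finset.mem_erase.2 ⟨hne.symm, hmem⟩)] at h
      rw [← Finset.insert_erase hX]
      refine .cons _ X (X.erase a) h (by simp) (Finset.mem_erase.2 ⟨hne.symm, hmem⟩) ?_
      intro b hb
      simp only [Finset.mem_inter, Finset.mem_biUnion, Finset.mem_erase, id] at hb
      obtain ⟨hbX, Z, ⟨hZX, hZ⟩, hbZ⟩ := hb
      refine Finset.mem_erase.2 ⟨?_, hbX⟩
      rintro rfl
      exact hZX (huniq Z hZ hbZ)
    · have key := h.replace (X := X.erase a) (a := a) (by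
        intro Y hY haY
        rcases Finset.mem_insert.1 hY with rfl | hY
        · simp at haY
        · exact (Finset.mem_erase.1 hY).1 (huniq Y (Finset.mem_erase.1 hY).2 haY))
      convert key using 1
      rw [Finset.image_insert, if_pos rfl, Finset.insert_erase ha]
      rw [Finset.image_congr (g := id), Finset.image_id, Finset.insert_erase hX]
      intro Y hY
      have : Y ≠ X.erase a := by
        rintro rfl
        exact hmem (Finset.mem_erase.1 hY).2
      simp [this]

theorem AttrHypergraph.Acyclic.hasRunningIntersection {H : AttrHypergraph Attr}
    (h : H.Acyclic) : HasRunningIntersection H.edges := by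
  obtain ⟨F, hF, hF0⟩ := h
  have hbase : HasRunningIntersection F := by
    rcases Finset.subset_singleton_iff.1 hF0 with rfl | rfl
    · exact .nil
    · exact .single _
  generalize H.edges = E at hF
  induction hF using Relation.ReflTransGen.head_induction_on with
  | refl => exact hbase
  | head hstep _ ih => exact ih.of_grahamStep hstep

end Reduction

/-! ### Semijoin programs and the full reducer of an acyclic hypergraph. -/

section Run

variable {Attr : Type u} [DecidableEq Attr] {K : Type w} [AddCommMonoid K] {Dom : Attr → Type v}
  {H : AttrHypergraph Attr} (S : SemijoinFunction K Dom)

theorem SemijoinProgram.run_append (π ρ : SemijoinProgram H) (R : KRelCollection K Dom H) :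
    SemijoinProgram.run S (π ++ ρ) R = SemijoinProgram.run S ρ (SemijoinProgram.run S π R) := by
  induction π generalizing R with
  | nil => rfl
  | cons e π ih => exact ih _

theorem SemijoinProgram.run_of_forall_ne (π : SemijoinProgram H) (R : KRelCollection K Dom H)
    (X : H.edges) (h : ∀ e ∈ π, e.1 ≠ X) : SemijoinProgram.run S π R X = R X := by
  induction π generalizing R with
  | nil => rfl
  | cons e π ih =>
    refine (ih _ fun e' he' => h e' (List.mem_cons_of_mem _ he')).trans ?_
    exact Function.update_of_ne (h e List.mem_cons_self).symm _ _

theorem SemijoinProgram.run_le (π : SemijoinProgram H) (R : KRelCollection K Dom H)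
    (X : H.edges) : (SemijoinProgram.run S π R X).LE (R X) := by
  induction π generalizing R with
  | nil => exact KRel.LE.refl _
  | cons e π ih =>
    refine (ih _).trans ?_
    by_cases h : X = e.1
    · subst h
      rw [Function.update_self]
      exact S.p2 _ _
    · rw [Function.update_of_ne h]
      exact KRel.LE.refl _

end Run

theorem KRel.marginal_eq_of_inner_subset {Attr : Type u} [DecidableEq Attr] {K : Type w}
    [AddCommMonoid K] {Dom : Attr → Type v} {X Y Z : Finset Attr} {R : KRel K Dom X}
    {T : KRel K Dom Y}
    (h : R.marginal (Finset.inter_subset_left : X ∩ Y ⊆ X) =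
      T.marginal (Finset.inter_subset_right : X ∩ Y ⊆ Y)) (hX : Z ⊆ X) (hY : Z ⊆ Y) :
    R.marginal hX = T.marginal hY := by
  rw [← KRel.marginal_marginal R Finset.inter_subset_left (Finset.subset_inter hX hY), h,
    KRel.marginal_marginal]

/-- A family of hyperedges with the running intersection property has a semijoin program that
makes its relations globally consistent, over every positive monoid with the inner consistency
property. -/
theorem HasRunningIntersection.exists_program {Attr : Type u} [DecidableEq Attr]
    {H : AttrHypergraph Attr} {F : Finset (Finset Attr)} (h : HasRunningIntersection F) :
    ∀ hF : F ⊆ H.edges, ∃ π : SemijoinProgram H, (∀ e ∈ π, e.1.1 ∈ F) ∧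
      ∀ (Dom : Attr → Type v) (K : Type w) [AddCommMonoid K], IsPositiveMonoid K →
        InnerConsistencyProperty K Dom → ∀ (S : SemijoinFunction K Dom)
          (R : KRelCollection K Dom H) (U : Finset Attr), F.biUnion id = U →
          ∃ W : KRel K Dom U, ∀ (X : Finset Attr) (hX : X ∈ F) (hU : X ⊆ U),
            W.marginal hU = SemijoinProgram.run S π R ⟨X, hF hX⟩ := by
  induction h with
  | nil =>
    intro hF
    exact ⟨[], by simp, fun _ _ _ _ _ _ _ _ _ => ⟨0, by simp⟩⟩
  | single X =>
    intro hF
    refine ⟨[], by simp, fun Dom K _ _ _ S R U hU => ?_⟩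
    have : X = U := by simpa using hU
    subst this
    refine ⟨R ⟨X, hF (by simp)⟩, fun Y hY hYX => ?_⟩
    obtain rfl := Finset.mem_singleton.1 hY
    exact KRel.marginal_self _ _
  | cons F X P hRI hX hP hXP ih =>
    intro hF
    have hF' : F ⊆ H.edges := (Finset.subset_insert X F).trans hF
    obtain ⟨π, hπ, hrun⟩ := ih hF'
    let x : H.edges := ⟨X, hF (Finset.mem_insert_self _ _)⟩
    let p : H.edges := ⟨P, hF' hP⟩
    have hpx : p ≠ x := fun e => by
      obtain rfl : P = X := congrArg Subtype.val e
      exact hX hP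
    -- The parent is cut down before the recursive program and the new edge after it; in between the
    -- relation over X stays untouched, since all targets of `π` lie in `F`.
    refine ⟨(p, x) :: (π ++ [(x, p)]), ?_, ?_⟩
    · intro e he
      simp only [List.mem_cons, List.mem_append, List.not_mem_nil, or_false] at he
      rcases he with rfl | he | rfl
      · exact Finset.mem_insert_of_mem hP
      · exact Finset.mem_insert_of_mem (hπ e he)
      · exact Finset.mem_insert_self _ _
    · intro Dom K _ hK hI S R U hU
      set R₁ : KRelCollection K Dom H := Function.update R p (S.toFun (R p) (R x)) with hR₁
      set R₂ := SemijoinProgram.run S π R₁ with hR₂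
      have hR : SemijoinProgram.run S ((p, x) :: (π ++ [(x, p)])) R =
          Function.update R₂ x (S.toFun (R₂ x) (R₂ p)) := by
        change SemijoinProgram.run S (π ++ [(x, p)]) R₁ = _
        rw [SemijoinProgram.run_append]
        rfl
      rw [hR]
      have hR₂x : R₂ x = R x := by
        rw [hR₂, SemijoinProgram.run_of_forall_ne S π R₁ x, hR₁, Function.update_of_ne hpx.symm]
        intro e he hex
        exact hX (by simpa [hex] using hπ e he)
      have hR₂p : (R₂ p).LE (S.toFun (R p) (R x)) := by
        have := SemijoinProgram.run_le S π R₁ p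
        rwa [hR₁, Function.update_self] at this
      have hle : ((R₂ p).marginal (Finset.inter_subset_right : X ∩ P ⊆ P)).LE
          ((R₂ x).marginal (Finset.inter_subset_left : X ∩ P ⊆ X)) := by
        have h1 := (hR₂p.marginal hK (Finset.inter_subset_left : P ∩ X ⊆ P)).trans
          (S.p3 (R p) (R x))
        have h2 := h1.marginal hK (Finset.inter_comm X P).subset
        rw [hR₂x]
        simpa only [KRel.marginal_marginal] using h2
      have heq := S.p4 (R₂ x) (R₂ p) hle
      obtain ⟨W, hW⟩ := hrun Dom K hK hI S R₁ _ rfl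
      -- X meets the earlier union inside P, where the reduced relation over X agrees with the
      -- marginal of `W`.
      obtain ⟨V, hV₁, hV₂⟩ := hI X (F.biUnion id) (S.toFun (R₂ x) (R₂ p)) W (by
        have hWp := hW P hP (Finset.subset_biUnion_of_mem id hP)
        rw [KRel.InnerConsistent,
          ← KRel.marginal_marginal W (Finset.subset_biUnion_of_mem id hP) hXP, hWp]
        exact KRel.marginal_eq_of_inner_subset heq _ hXP)
      have hU' : X ∪ F.biUnion id = U := by rw [← hU, Finset.biUnion_insert]; rfl
      subst hU'
      refine ⟨V, fun Y hY hYU => ?_⟩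
      by_cases hYX : Y = X
      · subst hYX
        rw [hV₁]
        exact (Function.update_self (f := R₂) x _).symm
      · have hYF : Y ∈ F := (Finset.mem_insert.1 hY).resolve_left hYX
        rw [Function.update_of_ne (fun e => hYX (congrArg Subtype.val e)), hR₂, ← hW Y hYF
          (Finset.subset_biUnion_of_mem id hYF), ← hV₂, KRel.marginal_marginal]

/-- An acyclic hypergraph has a semijoin program that is a full reducer over every positive monoid
with the inner consistency property. -/
theorem AttrHypergraph.Acyclic.exists_isFullReducer {Attr : Type u} [DecidableEq Attr]
    {H : AttrHypergraph Attr} (h : H.Acyclic) : ∃ π : SemijoinProgram H,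
      ∀ (Dom : Attr → Type v) (K : Type w) [AddCommMonoid K], IsPositiveMonoid K →
        InnerConsistencyProperty K Dom → ∀ S : SemijoinFunction K Dom, IsFullReducer π S := by
  obtain ⟨π, -, hπ⟩ := h.hasRunningIntersection.exists_program (H := H) (Finset.Subset.refl _)
  refine ⟨π, fun Dom K _ hK hI S R => ?_⟩
  obtain ⟨W, hW⟩ := hπ Dom K hK hI S R _ rfl
  exact ⟨W, fun X => hW X.1 X.2 _⟩

/-! ### Chordal and conformal hypergraphs are acyclic. -/

section Elimination

variable {α : Type u}

/-- Every two neighbours of `u` that are adjacent to a common connected set of non-neighbours of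
`u` are adjacent: there is no long cycle through `u` without a chord. -/
def NoChordlessCycle (r : α → α → Prop) : Prop :=
  ∀ (B : Set α) (w u s s' : α),
    (∀ b ∈ B, Relation.ReflTransGen (fun x y => x ∈ B ∧ y ∈ B ∧ r x y) w b) →
    (∀ b ∈ B, ¬ r u b) → r u s → r u s' → (∃ b ∈ B, r s b) → (∃ b ∈ B, r s' b) → r s s'

/-- Dirac's lemma: in a graph without long chordless cycles, a vertex `u` that is not adjacent to
all vertices has a simplicial non-neighbour. -/
theorem NoChordlessCycle.exists_simplicial_not_rel {r : α → α → Prop} (hr : NoChordlessCycle r)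
    (hsymm : ∀ x y, r x y → r y x) (W : Finset α) :
    (∀ x ∈ W, r x x) → ∀ u ∈ W, ∀ w ∈ W, ¬ r u w →
      ∃ a ∈ W, ¬ r u a ∧ ∀ x ∈ W, ∀ y ∈ W, r a x → r a y → r x y := by
  classical
  induction W using Finset.strongInduction with
  | H W ih =>
    intro hrefl u hu w hw huw
    -- B is the component of `w` among the non-neighbours of `u`. Below, W' adds the neighbours of
    -- `u` that touch B: a separator, which is a clique by `hr`. All neighbours of B in W lie in W',
    -- so a point of B simplicial in W' is simplicial in W.
    set B : Set α := {b | Relation.ReflTransGen (fun x y => r x y ∧ y ∈ W ∧ ¬ r u y) w b} with hB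
    have hwB : w ∈ B := Relation.ReflTransGen.refl
    have hBW : ∀ b ∈ B, b ∈ W ∧ ¬ r u b := by
      intro b hb
      rcases Relation.ReflTransGen.cases_tail hb with rfl | ⟨c, -, hc⟩
      · exact ⟨hw, huw⟩
      · exact hc.2
    have hconn : ∀ b ∈ B, Relation.ReflTransGen (fun x y => x ∈ B ∧ y ∈ B ∧ r x y) w b := by
      intro b hb
      induction hb with
      | refl => exact .refl
      | tail h1 h2 ih => exact ih.tail ⟨h1, h1.tail h2, h2.1⟩
    set W' := W.filter (fun x => x ∈ B ∨ (r u x ∧ ∃ b ∈ B, r x b)) with hW'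
    have huW' : u ∉ W' := by
      intro h
      rcases (Finset.mem_filter.1 h).2 with h | ⟨-, b, hb, hub⟩
      · exact (hBW u h).2 (hrefl u hu)
      · exact (hBW b hb).2 hub
    have hss : W' ⊂ W :=
      Finset.ssubset_iff_subset_ne.2 ⟨Finset.filter_subset _ _, fun h => huW' (h ▸ hu)⟩
    have hrefl' : ∀ x ∈ W', r x x := fun x hx => hrefl x (hss.1 hx)
    have hclosed : ∀ b ∈ B, ∀ x ∈ W, r b x → x ∈ W' := by
      intro b hb x hx hbx
      refine Finset.mem_filter.2 ⟨hx, ?_⟩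
      by_cases hux : r u x
      · exact Or.inr ⟨hux, b, hb, hsymm _ _ hbx⟩
      · exact Or.inl (Relation.ReflTransGen.tail hb ⟨hbx, hx, hux⟩)
    have hfinish : ∀ a ∈ B, (∀ x ∈ W', ∀ y ∈ W', r a x → r a y → r x y) →
        ∃ a ∈ W, ¬ r u a ∧ ∀ x ∈ W, ∀ y ∈ W, r a x → r a y → r x y := fun a ha h =>
      ⟨a, (hBW a ha).1, (hBW a ha).2, fun x hx y hy hax hay =>
        h x (hclosed a ha x hx hax) y (hclosed a ha y hy hay) hax hay⟩
    -- A simplicial point not adjacent to a separator vertex `s` cannot lie in the separator, so it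
    -- lies in B.
    by_cases h1 : ∃ s ∈ W', r u s ∧ ∃ y ∈ W', ¬ r s y
    · obtain ⟨s, hs, hus, y, hy, hsy⟩ := h1
      have hsB : ∃ b ∈ B, r s b := by
        rcases (Finset.mem_filter.1 hs).2 with h | h
        · exact absurd hus (hBW s h).2
        · exact h.2
      obtain ⟨a, ha, hsa, hsimp⟩ := ih W' hss hrefl' s hs y hy hsy
      rcases (Finset.mem_filter.1 ha).2 with haB | ⟨hua, hab⟩
      · exact hfinish a haB hsimp
      · exact absurd (hr B w u s a hconn (fun b hb => (hBW b hb).2) hus hua hsB hab) hsa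
    · push Not at h1
      -- Here separator vertices are adjacent to all of W', so a non-neighbour of any `b` lies in B;
      -- if there is no non-adjacent pair, W' is a clique and `w` will do.
      by_cases h2 : ∃ b ∈ W', ∃ y ∈ W', ¬ r b y
      · obtain ⟨b, hb, y, hy, hby⟩ := h2
        obtain ⟨a, ha, hba, hsimp⟩ := ih W' hss hrefl' b hb y hy hby
        rcases (Finset.mem_filter.1 ha).2 with haB | ⟨hua, -⟩
        · exact hfinish a haB hsimp
        · exact absurd (hsymm _ _ (h1 a ha hua b hb)) hba
      · push Not at h2
        exact hfinish w hwB fun x hx y hy _ _ => h2 x hx y hy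

theorem NoChordlessCycle.exists_simplicial {r : α → α → Prop} (hr : NoChordlessCycle r)
    (hsymm : ∀ x y, r x y → r y x) (W : Finset α) (hrefl : ∀ x ∈ W, r x x) (hW : W.Nonempty) :
    ∃ a ∈ W, ∀ x ∈ W, ∀ y ∈ W, r a x → r a y → r x y := by
  by_cases h : ∃ u ∈ W, ∃ w ∈ W, ¬ r u w
  · obtain ⟨u, hu, w, hw, huw⟩ := h
    obtain ⟨a, ha, -, h⟩ := hr.exists_simplicial_not_rel hsymm W hrefl u hu w hw huw
    exact ⟨a, ha, h⟩
  · push Not at h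
    obtain ⟨a, ha⟩ := hW
    exact ⟨a, ha, fun x hx y hy _ _ => h x hx y hy⟩

/-- Two nodes are adjacent if they lie in a common hyperedge. -/
def Coedge (F : Finset (Finset α)) (x y : α) : Prop := ∃ X ∈ F, x ∈ X ∧ y ∈ X

theorem Coedge.symm {F : Finset (Finset α)} {x y : α} (h : Coedge F x y) : Coedge F y x := by
  obtain ⟨X, hX, hx, hy⟩ := h
  exact ⟨X, hX, hy, hx⟩

/-- A family of sets is conformal if every non-empty clique of its graph lies in a member. -/
def IsConformal (F : Finset (Finset α)) : Prop :=
  ∀ C : Finset α, C.Nonempty → (∀ x ∈ C, ∀ y ∈ C, Coedge F x y) → ∃ X ∈ F, C ⊆ X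

variable [DecidableEq α]

theorem GrahamStep.reflTransGen_sdiff {F : Finset (Finset α)} {M : Finset α} (hM : M ∈ F)
    (S : Finset (Finset α)) : S ⊆ F → (∀ X ∈ S, X ⊆ M ∧ X ≠ M) →
      Relation.ReflTransGen GrahamStep F (F \ S) := by
  induction S using Finset.induction_on with
  | empty => intro _ _; simpa using Relation.ReflTransGen.refl
  | insert X S hX ih =>
    intro hSF hS
    refine (ih (fun Y hY => hSF (Finset.mem_insert_of_mem hY))
      (fun Y hY => hS Y (Finset.mem_insert_of_mem hY))).tail ?_
    have herase : F \ insert X S = (F \ S).erase X := by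
      ext Y
      simp only [Finset.mem_sdiff, Finset.mem_insert, Finset.mem_erase]
      tauto
    rw [herase]
    obtain ⟨h1, h2⟩ := hS X (Finset.mem_insert_self _ _)
    refine GrahamStep.removeEdge X M ?_ ?_ h2 h1
    · exact Finset.mem_sdiff.2 ⟨hSF (Finset.mem_insert_self _ _), hX⟩
    · exact Finset.mem_sdiff.2 ⟨hM, fun h => (hS M (Finset.mem_insert_of_mem h)).2 rfl⟩

/-- A conformal family without long chordless cycles can be reduced by Graham steps, together with
every family that generates the same down-set as its trace on a set of nodes. -/
theorem IsConformal.exists_graham_reduction {F : Finset (Finset α)} (hF : IsConformal F)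
    (hC : NoChordlessCycle (Coedge F)) (W : Finset α) :
    W ⊆ F.biUnion id → ∀ F' : Finset (Finset α), (∀ X ∈ F', ∃ Y ∈ F, X ⊆ Y ∩ W) →
      (∀ Y ∈ F, ∃ X ∈ F', Y ∩ W ⊆ X) →
      ∃ F'', Relation.ReflTransGen GrahamStep F' F'' ∧ F'' ⊆ {∅} := by
  classical
  induction W using Finset.strongInduction with
  | H W ih =>
    intro hWF F' h1 h2
    rcases W.eq_empty_or_nonempty with rfl | hW
    · refine ⟨F', .refl, fun X hX => ?_⟩
      obtain ⟨Y, -, hY⟩ := h1 X hX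
      simpa using hY
    have hrefl : ∀ x ∈ W, Coedge F x x := fun x hx => by
      obtain ⟨X, hX, hxX⟩ := Finset.mem_biUnion.1 (hWF hx)
      exact ⟨X, hX, hxX, hxX⟩
    -- The neighbourhood of a simplicial node is a clique, so by conformality one edge M contains
    -- every edge through `a`. Deleting those other edges leaves `a` in M alone, and then `a` can
    -- go.
    obtain ⟨a, haW, ha⟩ := hC.exists_simplicial (fun _ _ => Coedge.symm) W hrefl hW
    obtain ⟨M₀, hM₀, hCM₀⟩ := hF (W.filter (Coedge F a))
      ⟨a, Finset.mem_filter.2 ⟨haW, hrefl a haW⟩⟩ (fun x hx y hy =>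
        ha x (Finset.mem_filter.1 hx).1 y (Finset.mem_filter.1 hy).1 (Finset.mem_filter.1 hx).2
          (Finset.mem_filter.1 hy).2)
    obtain ⟨M, hM, hM₀M⟩ := h2 M₀ hM₀
    have hNM : ∀ x ∈ W, Coedge F a x → x ∈ M := fun x hx hax =>
      hM₀M (Finset.mem_inter.2 ⟨hCM₀ (Finset.mem_filter.2 ⟨hx, hax⟩), hx⟩)
    have haM : a ∈ M := hNM a haW (hrefl a haW)
    have hsub : ∀ X ∈ F', a ∈ X → X ⊆ M := by
      intro X hX haX x hx
      obtain ⟨Y, hY, hXY⟩ := h1 X hX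
      exact hNM x (Finset.mem_inter.1 (hXY hx)).2
        ⟨Y, hY, (Finset.mem_inter.1 (hXY haX)).1, (Finset.mem_inter.1 (hXY hx)).1⟩
    set S := F'.filter (fun X => a ∈ X ∧ X ≠ M) with hS
    have hstep₁ := GrahamStep.reflTransGen_sdiff hM S (Finset.filter_subset _ _) (fun X hX => by
      obtain ⟨hX, haX, hne⟩ := Finset.mem_filter.1 hX
      exact ⟨hsub X hX haX, hne⟩)
    have hmem : ∀ X, X ∈ F' \ S ↔ X ∈ F' ∧ (a ∈ X → X = M) := by
      intro X
      simp only [hS, Finset.mem_sdiff, Finset.mem_filter]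
      tauto
    have hstep₂ : GrahamStep (F' \ S) (insert (M.erase a) ((F' \ S).erase M)) :=
      GrahamStep.removeNode M a ((hmem M).2 ⟨hM, fun _ => rfl⟩) haM
        (fun Y hY haY => ((hmem Y).1 hY).2 haY)
    obtain ⟨F'', hred, hF''⟩ := ih (W.erase a) (Finset.erase_ssubset haW)
      ((Finset.erase_subset _ _).trans hWF) (insert (M.erase a) ((F' \ S).erase M))
      (by
        intro X hX
        rcases Finset.mem_insert.1 hX with rfl | hX
        · obtain ⟨Y, hY, hMY⟩ := h1 M hM
          refine ⟨Y, hY, ?_⟩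
          rw [Finset.inter_erase]
          exact Finset.erase_subset_erase a hMY
        · obtain ⟨hXM, hX⟩ := Finset.mem_erase.1 hX
          obtain ⟨hX, haX⟩ := (hmem X).1 hX
          obtain ⟨Y, hY, hXY⟩ := h1 X hX
          refine ⟨Y, hY, ?_⟩
          rw [Finset.inter_erase]
          exact Finset.subset_erase.2 ⟨hXY, fun h => hXM (haX h)⟩)
      (by
        intro Y hY
        obtain ⟨X, hX, hYX⟩ := h2 Y hY
        rw [Finset.inter_erase]
        by_cases haX : a ∈ X
        · exact ⟨M.erase a, Finset.mem_insert_self _ _,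
            Finset.erase_subset_erase a (hYX.trans (hsub X hX haX))⟩
        · refine ⟨X, Finset.mem_insert_of_mem (Finset.mem_erase.2 ⟨?_, (hmem X).2
            ⟨hX, fun h => absurd h haX⟩⟩), (Finset.erase_subset _ _).trans hYX⟩
          rintro rfl
          exact haX haM)
    exact ⟨F'', (hstep₁.tail hstep₂).trans hred, hF''⟩

theorem IsConformal.acyclic {H : AttrHypergraph α} (hF : IsConformal H.edges)
    (hC : NoChordlessCycle (Coedge H.edges)) : H.Acyclic :=
  hF.exists_graham_reduction hC _ (Finset.Subset.refl _) H.edges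
    (fun X hX => ⟨X, hX, Finset.subset_inter (Finset.Subset.refl _)
      (Finset.subset_biUnion_of_mem id hX)⟩)
    (fun Y hY => ⟨Y, hY, Finset.inter_subset_left⟩)

end Elimination

/-! ### From full reducers to local-to-global consistency. -/

section LocalToGlobal

variable {Attr : Type u} [DecidableEq Attr] {K : Type w} [AddCommMonoid K] {Dom : Attr → Type v}
  {H : AttrHypergraph Attr}

/-- The local-to-global consistency property of `H`: every collection of pairwise inner consistent
`K`-relations over `H` is globally consistent. -/
def LocalToGlobal (K : Type w) [AddCommMonoid K] (Dom : Attr → Type v) (H : AttrHypergraph Attr) :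
    Prop :=
  ∀ R : KRelCollection K Dom H, (∀ X Y, (R X).InnerConsistent (R Y)) → R.GloballyConsistent

theorem SemijoinProgram.run_of_consistent (S : SemijoinFunction K Dom) (π : SemijoinProgram H)
    (R : KRelCollection K Dom H) (hR : ∀ X Y, (R X).Consistent (R Y)) :
    SemijoinProgram.run S π R = R := by
  induction π with
  | nil => rfl
  | cons e π ih =>
    change SemijoinProgram.run S π (Function.update R e.1 (S.toFun (R e.1) (R e.2))) = R
    rw [S.p1 _ _ (hR _ _), Function.update_eq_self, ih]

/-- By (P1) the program returns a pairwise consistent collection unchanged, so the globally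
consistent output is the input itself. -/
theorem HasFullReducer.localToGlobal (h : HasFullReducer K Dom H)
    (hI : InnerConsistencyProperty K Dom) : LocalToGlobal K Dom H := by
  intro R hR
  obtain ⟨π, S, hπ⟩ := h
  have := hπ R
  rwa [SemijoinProgram.run_of_consistent S π R fun X Y => hI _ _ _ _ (hR X Y)] at this

/-- If `H` has the local-to-global property over a nontrivial positive monoid, then some tuple
projects into the supports of all members of a nonzero pairwise inner consistent collection of
multisets. -/
theorem LocalToGlobal.exists_tuple [Nontrivial K] (hK : IsPositiveMonoid K)
    (h : LocalToGlobal K Dom H) (g : KRelCollection ℕ Dom H)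
    (hg : ∀ X Y, (g X).InnerConsistent (g Y)) (hne : ∃ X, g X ≠ 0) :
    ∃ t : Tup Dom (H.edges.biUnion id), ∀ X : H.edges,
      g X (Finset.restrict₂ (π := Dom) (Finset.subset_biUnion_of_mem id X.2) t) ≠ 0 := by
  -- The map n ↦ n • p is additive, so it preserves inner consistency, and positivity keeps nonzero
  -- values nonzero.
  obtain ⟨p, hp⟩ := exists_ne (0 : K)
  obtain ⟨W, hW⟩ := h (fun X => (g X).mapRange (fun n => n • p) (zero_nsmul p)) (by
    intro X Y
    have := hg X Y
    simp only [KRel.InnerConsistent, KRel.marginal] at this ⊢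
    rw [Finsupp.mapDomain_mapRange _ _ _ _ (fun m n => add_nsmul p m n),
      Finsupp.mapDomain_mapRange _ _ _ _ (fun m n => add_nsmul p m n), this])
  have hW0 : W ≠ 0 := by
    rintro rfl
    obtain ⟨X, hX⟩ := hne
    obtain ⟨r, hr⟩ := Finsupp.ne_iff.1 hX
    have h0 := DFunLike.congr_fun (hW X) r
    simp only [KRel.marginal, Finsupp.mapDomain_zero, Finsupp.mapRange_apply] at h0
    exact hK.nsmul_ne_zero hp hr h0.symm
  obtain ⟨t, ht⟩ := Finsupp.ne_iff.1 hW0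
  refine ⟨t, fun X h0 => ?_⟩
  have := Finsupp.mapDomain_ne_zero_of_ne_zero hK
    (Finset.restrict₂ (π := Dom) (Finset.subset_biUnion_of_mem id X.2)) ht
  have hX := DFunLike.congr_fun (hW X)
    (Finset.restrict₂ (π := Dom) (Finset.subset_biUnion_of_mem id X.2) t)
  rw [KRel.marginal, Finsupp.mapRange_apply, h0, zero_nsmul] at hX
  exact this hX

end LocalToGlobal

/-! ### Two-valued tuples and the exclusion of chordless cycles. -/

section IndicatorTuple

variable {Attr : Type u} (Dom : Attr → Type v) [∀ A, Nontrivial (Dom A)]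

open Classical in
/-- The `X`-tuple that takes one of two fixed values, according to membership in `D`. -/
noncomputable def indicatorTuple (D : Set Attr) (X : Finset Attr) : Tup Dom X := fun A =>
  if (A : Attr) ∈ D then (exists_pair_ne (Dom A)).choose_spec.choose
  else (exists_pair_ne (Dom A)).choose

variable {Dom}

theorem indicatorTuple_eq_iff {D E : Set Attr} {X : Finset Attr} :
    indicatorTuple Dom D X = indicatorTuple Dom E X ↔ ∀ A ∈ X, (A ∈ D ↔ A ∈ E) := by
  constructor
  · intro h A hA
    have := congrFun h ⟨A, hA⟩
    have hne := (exists_pair_ne (Dom A)).choose_spec.choose_spec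
    by_cases h1 : A ∈ D <;> by_cases h2 : A ∈ E <;> simp [indicatorTuple, h1, h2] at this ⊢
    · exact hne this.symm
    · exact hne this
  · intro h
    funext A
    by_cases hA : (A : Attr) ∈ D
    · simp [indicatorTuple, hA, (h A A.2).1 hA]
    · have hE : (A : Attr) ∉ E := fun hE => hA ((h A A.2).2 hE)
      simp [indicatorTuple, hA, hE]

theorem restrict₂_indicatorTuple (D : Set Attr) {X Y : Finset Attr} (h : Y ⊆ X) :
    Finset.restrict₂ (π := Dom) h (indicatorTuple Dom D X) = indicatorTuple Dom D Y := rfl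

variable [DecidableEq Attr] {K : Type w} [AddCommMonoid K] {H : AttrHypergraph Attr}

/-- `LocalToGlobal.exists_tuple` for multisets of indicator tuples. -/
theorem LocalToGlobal.exists_set [Nontrivial K] (hK : IsPositiveMonoid K)
    (h : LocalToGlobal K Dom H) (g : KRelCollection ℕ Dom H)
    (hg : ∀ X Y, (g X).InnerConsistent (g Y)) (hne : ∃ X, g X ≠ 0)
    (P : H.edges → Set Attr → Prop)
    (hP : ∀ X r, g X r ≠ 0 → ∃ D, P X D ∧ r = indicatorTuple Dom D X) :
    ∃ T : Set Attr, ∀ X : H.edges, g X (indicatorTuple Dom T X) ≠ 0 ∧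
      ∃ D, P X D ∧ ∀ A ∈ X.1, (A ∈ T ↔ A ∈ D) := by
  obtain ⟨t, ht⟩ := h.exists_tuple hK g hg hne
  refine ⟨{A | ∃ hA : A ∈ H.edges.biUnion id, t ⟨A, hA⟩ = indicatorTuple Dom Set.univ _ ⟨A, hA⟩},
    fun X => ?_⟩
  obtain ⟨D, hPD, hD⟩ := hP X _ (ht X)
  have key : ∀ A ∈ X.1, (A ∈ {A | ∃ hA : A ∈ H.edges.biUnion id,
      t ⟨A, hA⟩ = indicatorTuple Dom Set.univ _ ⟨A, hA⟩} ↔ A ∈ D) := by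
    intro A hA
    have hAU : A ∈ H.edges.biUnion id := Finset.subset_biUnion_of_mem id X.2 hA
    have h1 : t ⟨A, hAU⟩ = indicatorTuple Dom D X ⟨A, hA⟩ := congrFun hD ⟨A, hA⟩
    have hne := (exists_pair_ne (Dom A)).choose_spec.choose_spec
    simp only [Set.mem_ofPred_eq, hAU, exists_true_left, h1]
    by_cases h2 : A ∈ D <;> simp [indicatorTuple, h2]
    exact hne
  refine ⟨?_, D, hPD, key⟩
  rw [indicatorTuple_eq_iff.2 key, ← hD]
  exact ht X

/-- Local-to-global consistency excludes long chordless cycles: on such a cycle there is a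
collection of relations, each with two complementary tuples, with an odd number of twists. -/
theorem LocalToGlobal.noChordlessCycle [Nontrivial K] (hK : IsPositiveMonoid K)
    (h : LocalToGlobal K Dom H) : NoChordlessCycle (Coedge H.edges) := by
  intro B w u s s' hconn huB hus hus' ⟨b₀, hb₀, hsb₀⟩ ⟨b₁, hb₁, hsb₁⟩
  by_contra hss
  have hs'B : s' ∉ B := fun h => huB s' h hus'
  -- W is the cycle, with B in place of a path. The two tuples over X make the cycle nodes of X take
  -- equal values, except that `s'` takes the opposite value when X meets B: the only twist lies
  -- between `s'` and B.
  let W : Set Attr := {A | A = u ∨ A = s ∨ A = s' ∨ A ∈ B}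
  let D : Finset Attr → Set Attr := fun X => {A | A = s' ∧ ∃ b ∈ B, b ∈ X}
  let g : KRelCollection ℕ Dom H := fun X =>
    Finsupp.single (indicatorTuple Dom (D X) X) 1 + Finsupp.single (indicatorTuple Dom (W \ D X) X) 1
  have hgm : ∀ (X : H.edges) (Z : Finset Attr) (hZ : Z ⊆ X.1), (g X).marginal hZ =
      Finsupp.single (indicatorTuple Dom (D X) Z) 1 +
        Finsupp.single (indicatorTuple Dom (W \ D X) Z) 1 := by
    intro X Z hZ
    simp only [g, KRel.marginal, Finsupp.mapDomain_add, Finsupp.mapDomain_single,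
      restrict₂_indicatorTuple]
  have hsame : ∀ (X Y : H.edges) (Z : Finset Attr) (hX : Z ⊆ X.1) (hY : Z ⊆ Y.1),
      (∀ A ∈ Z, (A ∈ D X ↔ A ∈ D Y)) → (g X).marginal hX = (g Y).marginal hY := by
    intro X Y Z hX hY hZ
    rw [hgm, hgm, indicatorTuple_eq_iff.2 hZ, (indicatorTuple_eq_iff (D := W \ D X) (E := W \ D Y)).2 fun A hA =>
      and_congr_right' (not_congr (hZ A hA))]
  have hflip : ∀ (X Y : H.edges) (Z : Finset Attr) (hX : Z ⊆ X.1) (hY : Z ⊆ Y.1), s' ∈ Z →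
      (∃ b ∈ B, b ∈ X.1) → (¬ ∃ b ∈ B, b ∈ Y.1) → (g X).marginal hX = (g Y).marginal hY := by
    intro X Y Z hX hY hs' hBX hBY
    obtain ⟨b, hb, hbX⟩ := hBX
    -- A twisted and an untwisted edge through `s'` share no other cycle node, so there the twist
    -- merely swaps the two tuples.
    have hWZ : ∀ A ∈ Z, A ∈ W → A = s' := by
      rintro A hA (rfl | rfl | rfl | hAB)
      · exact absurd ⟨X.1, X.2, hX hA, hbX⟩ (huB b hb)
      · exact absurd ⟨X.1, X.2, hX hA, hX hs'⟩ hss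
      · rfl
      · exact absurd ⟨A, hAB, hY hA⟩ hBY
    have hDX : ∀ A, A ∈ D X ↔ A = s' := fun A => ⟨fun h => h.1, fun h => ⟨h, b, hb, hbX⟩⟩
    have hDY : ∀ A, A ∉ D Y := fun A h => hBY h.2
    have hs'W : s' ∈ W := Or.inr (Or.inr (Or.inl rfl))
    rw [hgm, hgm, add_comm]
    congr 2
    · refine indicatorTuple_eq_iff.2 fun A hA => ?_
      exact iff_of_false (fun h => h.2 ((hDX A).2 (hWZ A hA h.1))) (hDY A)
    · refine indicatorTuple_eq_iff.2 fun A hA => ?_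
      exact (hDX A).trans ⟨fun e => ⟨e ▸ hs'W, hDY A⟩, fun h => hWZ A hA h.1⟩
  have hg : ∀ X Y, (g X).InnerConsistent (g Y) := by
    intro X Y
    by_cases hs' : s' ∈ X.1 ∩ Y.1
    · by_cases hX : ∃ b ∈ B, b ∈ X.1 <;> by_cases hY : ∃ b ∈ B, b ∈ Y.1
      · exact hsame X Y _ _ _ fun A _ => by simp only [D, Set.mem_ofPred_eq, hX, hY]
      · exact hflip X Y _ _ _ hs' hX hY
      · exact (hflip Y X _ _ _ hs' hY hX).symm
      · exact hsame X Y _ _ _ fun A _ => by simp only [D, Set.mem_ofPred_eq, hX, hY]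
    · refine hsame X Y _ _ _ fun A hA => ?_
      have : A ≠ s' := fun e => hs' (e ▸ hA)
      simp only [D, Set.mem_ofPred_eq, this, false_and]
  obtain ⟨X₀, hX₀, huX₀, hsX₀⟩ := id hus
  obtain ⟨X₁, hX₁, huX₁, hsX₁⟩ := id hus'
  obtain ⟨X₂, hX₂, hsX₂, hbX₂⟩ := id hsb₀
  obtain ⟨X₃, hX₃, hsX₃, hbX₃⟩ := id hsb₁
  obtain ⟨T, hT⟩ := h.exists_set hK g hg
    ⟨⟨X₀, hX₀⟩, fun h0 => by
      have := DFunLike.congr_fun h0 (indicatorTuple Dom (D X₀) X₀)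
      simp [g] at this⟩
    (fun X E => E = D X ∨ E = W \ D X) (by
      intro X r hr
      by_contra hcon
      push Not at hcon
      refine hr ?_
      have h1 := hcon (D X) (Or.inl rfl)
      have h2 := hcon (W \ D X) (Or.inr rfl)
      simp [g, h1.symm, h2.symm])
  have hTX : ∀ X ∈ H.edges, (∀ A ∈ X, (A ∈ T ↔ A ∈ D X)) ∨
      (∀ A ∈ X, (A ∈ T ↔ A ∈ W ∧ A ∉ D X)) := by
    intro X hX
    obtain ⟨-, E, rfl | rfl, hE⟩ := hT ⟨X, hX⟩
    · exact Or.inl hE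
    · exact Or.inr hE
  have hst : ∀ X ∈ H.edges, ∀ x ∈ X, ∀ y ∈ X, x ∈ W → y ∈ W → x ∉ D X → y ∉ D X →
      (x ∈ T ↔ y ∈ T) := by
    intro X hX x hx y hy hxW hyW hxD hyD
    rcases hTX X hX with h | h
    · exact iff_of_false (fun hT => hxD ((h x hx).1 hT)) (fun hT => hyD ((h y hy).1 hT))
    · exact iff_of_true ((h x hx).2 ⟨hxW, hxD⟩) ((h y hy).2 ⟨hyW, hyD⟩)
  have hT₁ : u ∈ T ↔ s ∈ T :=
    hst X₀ hX₀ u huX₀ s hsX₀ (Or.inl rfl) (Or.inr (Or.inl rfl))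
      (fun h => by obtain ⟨-, b, hb, hbX⟩ := h; exact huB b hb ⟨X₀, hX₀, huX₀, hbX⟩)
      (fun h => by obtain ⟨-, b, hb, hbX⟩ := h; exact huB b hb ⟨X₀, hX₀, huX₀, hbX⟩)
  have hT₂ : u ∈ T ↔ s' ∈ T :=
    hst X₁ hX₁ u huX₁ s' hsX₁ (Or.inl rfl) (Or.inr (Or.inr (Or.inl rfl)))
      (fun h => by obtain ⟨-, b, hb, hbX⟩ := h; exact huB b hb ⟨X₁, hX₁, huX₁, hbX⟩)
      (fun h => by obtain ⟨-, b, hb, hbX⟩ := h; exact huB b hb ⟨X₁, hX₁, huX₁, hbX⟩)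
  have hBD : ∀ b ∈ B, ∀ X, b ∉ D X := fun b hb X h => hs'B (h.1 ▸ hb)
  have hBW : ∀ b ∈ B, b ∈ W := fun b hb => Or.inr (Or.inr (Or.inr hb))
  have hT₃ : s ∈ T ↔ b₀ ∈ T :=
    hst X₂ hX₂ s hsX₂ b₀ hbX₂ (Or.inr (Or.inl rfl)) (hBW b₀ hb₀)
      (fun h => hss (h.1 ▸ ⟨X₂, hX₂, hsX₂, hsX₂⟩)) (hBD b₀ hb₀ _)
  have hTB : ∀ b ∈ B, (w ∈ T ↔ b ∈ T) := by
    intro b hb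
    have := hconn b hb
    clear hb
    induction this with
    | refl => rfl
    | tail _ hbc ih =>
      obtain ⟨hb, hc, X, hX, hbX, hcX⟩ := hbc
      exact ih.trans (hst X hX _ hbX _ hcX (hBW _ hb) (hBW _ hc) (hBD _ hb _) (hBD _ hc _))
  have hT₄ : ¬ (s' ∈ T ↔ b₁ ∈ T) := by
    have h1 : s' ∈ D X₃ := ⟨rfl, b₁, hb₁, hbX₃⟩
    have h2 := hBD b₁ hb₁ X₃
    have h3 := hBW b₁ hb₁
    intro hiff
    rcases hTX X₃ hX₃ with h | h
    · exact h2 ((h b₁ hbX₃).1 (hiff.1 ((h s' hsX₃).2 h1)))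
    · exact ((h s' hsX₃).1 (hiff.2 ((h b₁ hbX₃).2 ⟨h3, h2⟩))).2 h1
  -- Going round by u, s, b₀, w, b₁ gives `s'` and `b₁` equal values, against the twist.
  exact hT₄ (hT₂.symm.trans (hT₁.trans (hT₃.trans ((hTB b₀ hb₀).symm.trans (hTB b₁ hb₁)))))

end IndicatorTuple

/-! ### Signs of subsets. -/

section Toggle

variable {α : Type u} [DecidableEq α]

/-- Change the membership of `v` in `D`. -/
def Finset.toggle (v : α) (D : Finset α) : Finset α := if v ∈ D then D.erase v else insert v D

theorem Finset.toggle_toggle (v : α) (D : Finset α) : (D.toggle v).toggle v = D := by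
  by_cases h : v ∈ D
  · simp [Finset.toggle, h, Finset.insert_erase h]
  · simp [Finset.toggle, h, Finset.erase_insert h]

theorem Finset.mem_toggle_of_ne {v a : α} (h : a ≠ v) (D : Finset α) :
    a ∈ D.toggle v ↔ a ∈ D := by
  by_cases hv : v ∈ D <;> simp [Finset.toggle, hv, h]

theorem Finset.toggle_subset {v : α} {C D : Finset α} (hv : v ∈ C) (hD : D ⊆ C) :
    D.toggle v ⊆ C := by
  by_cases h : v ∈ D
  · simpa only [Finset.toggle, if_pos h] using (Finset.erase_subset v D).trans hD
  · simp [Finset.toggle, h, Finset.insert_subset hv hD]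

theorem Finset.card_toggle_of_mem {v : α} {D : Finset α} (h : v ∈ D) :
    (D.toggle v).card + 1 = D.card := by
  simpa [Finset.toggle, h] using Finset.card_erase_add_one h

theorem Finset.card_toggle_of_notMem {v : α} {D : Finset α} (h : v ∉ D) :
    (D.toggle v).card = D.card + 1 := by
  simp [Finset.toggle, h]

theorem Finset.eq_or_eq_toggle {v : α} {D E : Finset α} (h : ∀ a, a ≠ v → (a ∈ D ↔ a ∈ E)) :
    D = E ∨ D = E.toggle v := by
  by_cases hv : v ∈ D ↔ v ∈ E
  · left
    ext a
    by_cases ha : a = v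
    · rw [ha, hv]
    · exact h a ha
  · right
    ext a
    by_cases ha : a = v
    · subst ha
      by_cases hE : a ∈ E <;> simp [Finset.toggle, hE] at hv ⊢ <;> exact hv
    · rw [Finset.mem_toggle_of_ne ha, h a ha]

/-- The cardinalities that carry a negative sign in an alternating pattern `- + + - + - + ⋯`. -/
def NegativeCard (k : ℕ) : Prop := k = 0 ∨ 3 ≤ k ∧ k % 2 = 1

theorem NegativeCard.not_toggle {v : α} {D : Finset α} (h : NegativeCard D.card) :
    ¬ NegativeCard (D.toggle v).card := by
  unfold NegativeCard at *
  by_cases hv : v ∈ D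
  · have := Finset.card_toggle_of_mem hv
    omega
  · have := Finset.card_toggle_of_notMem hv
    omega

/-- In a set with at least three elements, every subset has a neighbour of opposite sign. -/
theorem exists_toggle_negativeCard {C D : Finset α} (hC : 3 ≤ C.card) (hD : D ⊆ C) :
    ∃ v ∈ C, (NegativeCard D.card ↔ ¬ NegativeCard (D.toggle v).card) := by
  by_cases h : D.card = 0 ∨ D.card = 2
  · obtain ⟨v, hv, hvD⟩ : ∃ v ∈ C, v ∉ D :=
      Finset.exists_mem_notMem_of_card_lt_card (by omega)
    have := Finset.card_toggle_of_notMem hvD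
    refine ⟨v, hv, ?_⟩
    unfold NegativeCard
    omega
  · obtain ⟨v, hv⟩ : D.Nonempty := Finset.card_pos.1 (by omega)
    have := Finset.card_toggle_of_mem hv
    refine ⟨v, hD hv, ?_⟩
    unfold NegativeCard
    omega

end Toggle

/-! ### Conformality from a signed family of subsets. -/

section IndicatorSum

variable {Attr : Type u} {Dom : Attr → Type v} [∀ A, Nontrivial (Dom A)]

variable (Dom) in
/-- The multiset of the indicator tuples of a family of sets. -/
noncomputable def indicatorSum (𝒟 : Finset (Finset Attr)) (X : Finset Attr) : KRel ℕ Dom X :=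
  ∑ D ∈ 𝒟, Finsupp.single (indicatorTuple Dom (D : Set Attr) X) 1

theorem marginal_indicatorSum (𝒟 : Finset (Finset Attr)) {X Y : Finset Attr} (h : Y ⊆ X) :
    (indicatorSum Dom 𝒟 X).marginal h = indicatorSum Dom 𝒟 Y := by
  simp only [KRel.marginal, indicatorSum, Finsupp.mapDomain_finsetSum, Finsupp.mapDomain_single,
    restrict₂_indicatorTuple]

open Classical in
theorem indicatorSum_apply (𝒟 : Finset (Finset Attr)) {X : Finset Attr} (r : Tup Dom X) :
    indicatorSum Dom 𝒟 X r =
      (𝒟.filter fun D : Finset Attr => indicatorTuple Dom (D : Set Attr) X = r).card := by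
  simp [indicatorSum, Finsupp.finsetSum_apply, Finsupp.single_apply]

theorem exists_of_indicatorSum_ne_zero {𝒟 : Finset (Finset Attr)} {X : Finset Attr}
    {r : Tup Dom X} (h : indicatorSum Dom 𝒟 X r ≠ 0) :
    ∃ D ∈ 𝒟, r = indicatorTuple Dom (D : Set Attr) X := by
  classical
  rw [indicatorSum_apply] at h
  obtain ⟨D, hD⟩ := Finset.card_pos.1 (Nat.pos_of_ne_zero h)
  exact ⟨D, (Finset.mem_filter.1 hD).1, (Finset.mem_filter.1 hD).2.symm⟩

variable [DecidableEq Attr]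

/-- A node outside X is invisible over X, so toggling it injects one fibre over `r` into the other.
-/
theorem indicatorSum_apply_le {𝒟 ℰ : Finset (Finset Attr)} {X : Finset Attr} {r : Tup Dom X}
    {v : Attr} (hv : v ∉ X)
    (h : ∀ D ∈ 𝒟, indicatorTuple Dom (D : Set Attr) X = r → D.toggle v ∈ ℰ) :
    indicatorSum Dom 𝒟 X r ≤ indicatorSum Dom ℰ X r := by
  classical
  rw [indicatorSum_apply, indicatorSum_apply]
  refine Finset.card_le_card_of_injOn (Finset.toggle v) (fun D hD => ?_) (fun D _ E _ hDE => ?_)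
  · obtain ⟨hD, hr⟩ := Finset.mem_filter.1 hD
    refine Finset.mem_filter.2 ⟨h D hD hr, hr ▸ indicatorTuple_eq_iff.2 fun A hA => ?_⟩
    exact Finset.mem_toggle_of_ne (fun e : A = v => hv (e ▸ hA)) D
  · rw [← Finset.toggle_toggle v D, ← Finset.toggle_toggle v E]
    exact congrArg (Finset.toggle v) hDE

variable {K : Type w} [AddCommMonoid K] {H : AttrHypergraph Attr}

/-- Under local-to-global consistency, a set of at least three nodes lies in a hyperedge if it does
so after deletion of any node. -/
theorem LocalToGlobal.exists_edge_of_erase [Nontrivial K] (hK : IsPositiveMonoid K)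
    (h : LocalToGlobal K Dom H) {C : Finset Attr} (hC : 3 ≤ C.card)
    (hsub : ∀ v ∈ C, ∃ X ∈ H.edges, C.erase v ⊆ X) : ∃ X ∈ H.edges, C ⊆ X := by
  classical
  by_contra hcon
  have hout : ∀ X ∈ H.edges, ∃ v ∈ C, v ∉ X := fun X hX => by
    by_contra hX'
    push Not at hX'
    exact hcon ⟨X, hX, hX'⟩
  -- Signs by parity alone would cancel over every edge missing a node of C. With the signs of sizes
  -- 0 and 1 exchanged, toggling still never joins two negative sets, but sizes 1 and 2 are both
  -- positive and leave something over.
  set 𝒟₁ := C.powerset.filter (fun D => NegativeCard D.card) with h𝒟₁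
  set 𝒟₀ := C.powerset.filter (fun D => ¬ NegativeCard D.card) with h𝒟₀
  have hle : ∀ X : H.edges, indicatorSum Dom 𝒟₁ X ≤ indicatorSum Dom 𝒟₀ X := by
    intro X r
    obtain ⟨v, hvC, hvX⟩ := hout X X.2
    refine indicatorSum_apply_le hvX fun D hD _ => ?_
    obtain ⟨hDC, hD⟩ := Finset.mem_filter.1 hD
    exact Finset.mem_filter.2 ⟨Finset.mem_powerset.2
      (Finset.toggle_subset hvC (Finset.mem_powerset.1 hDC)), hD.not_toggle⟩
  -- By `hle` the truncated subtraction is exact, so the `g X` behave as marginals of one signed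
  -- multiset and are inner consistent.
  let g : KRelCollection ℕ Dom H := fun X => indicatorSum Dom 𝒟₀ X - indicatorSum Dom 𝒟₁ X
  have hadd : ∀ X : H.edges, g X + indicatorSum Dom 𝒟₁ X = indicatorSum Dom 𝒟₀ X :=
    fun X => tsub_add_cancel_of_le (hle X)
  have hmarg : ∀ (X : H.edges) (Z : Finset Attr) (hZ : Z ⊆ X.1),
      (g X).marginal hZ + indicatorSum Dom 𝒟₁ Z = indicatorSum Dom 𝒟₀ Z := by
    intro X Z hZ
    rw [← marginal_indicatorSum 𝒟₁ hZ, ← marginal_indicatorSum 𝒟₀ hZ, ← hadd X]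
    exact Finsupp.mapDomain_add.symm
  have hg : ∀ X Y, (g X).InnerConsistent (g Y) := fun X Y =>
    add_right_cancel ((hmarg X _ Finset.inter_subset_left).trans
      (hmarg Y _ Finset.inter_subset_right).symm)
  have hfiber : ∀ (X : Finset Attr) (v : Attr), C.erase v ⊆ X → ∀ D ⊆ C, ∀ E ⊆ C,
      indicatorTuple Dom (D : Set Attr) X = indicatorTuple Dom (E : Set Attr) X →
        D = E ∨ D = E.toggle v := by
    intro X v hX D hD E hE hDE
    refine Finset.eq_or_eq_toggle fun a ha => ?_
    by_cases haC : a ∈ C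
    · exact indicatorTuple_eq_iff.1 hDE a (hX (Finset.mem_erase.2 ⟨ha, haC⟩))
    · exact iff_of_false (fun h => haC (hD h)) (fun h => haC (hE h))
  have hne : ∃ X, g X ≠ 0 := by
    obtain ⟨v, hv⟩ : C.Nonempty := Finset.card_pos.1 (by omega)
    obtain ⟨x, hx, hxv⟩ := Finset.exists_mem_ne (by omega : 1 < C.card) v
    obtain ⟨X, hX, hCX⟩ := hsub v hv
    refine ⟨⟨X, hX⟩, fun h0 => ?_⟩
    -- The fibre of {x} consists of {x} and {x, v}, both positive, so it cannot cancel.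
    have h1 := DFunLike.congr_fun (hadd ⟨X, hX⟩) (indicatorTuple Dom (({x} : Finset Attr) : Set Attr) X)
    rw [h0, zero_add] at h1
    have hxC : ({x} : Finset Attr) ⊆ C := Finset.singleton_subset_iff.2 hx
    have hcard := Finset.card_toggle_of_notMem
      (show v ∉ ({x} : Finset Attr) by simpa using hxv.symm)
    rw [Finset.card_singleton] at hcard
    have hpos : indicatorSum Dom 𝒟₀ X
        (indicatorTuple Dom (({x} : Finset Attr) : Set Attr) X) ≠ 0 := by
      rw [indicatorSum_apply]
      refine Finset.card_ne_zero_of_mem (a := ({x} : Finset Attr)) (Finset.mem_filter.2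
        ⟨Finset.mem_filter.2 ⟨Finset.mem_powerset.2 hxC, ?_⟩, rfl⟩)
      simp [NegativeCard]
    rw [← h1] at hpos
    obtain ⟨D, hD, hDx⟩ := exists_of_indicatorSum_ne_zero hpos
    obtain ⟨hDC, hD⟩ := Finset.mem_filter.1 hD
    rcases hfiber X v hCX D (Finset.mem_powerset.1 hDC) {x} hxC hDx.symm with rfl | rfl
    · simp [NegativeCard] at hD
    · simp [NegativeCard, hcard] at hD
  obtain ⟨T, hT⟩ := h.exists_set hK g hg hne (fun _ E => E ⊆ (C : Set Attr)) (by
    intro X r hr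
    have : indicatorSum Dom 𝒟₀ X r ≠ 0 := by
      rw [← hadd X, Finsupp.add_apply]
      omega
    obtain ⟨D, hD, hDr⟩ := exists_of_indicatorSum_ne_zero this
    exact ⟨D, by simpa using (Finset.mem_filter.1 hD).1, hDr⟩)
  set D := C.filter (· ∈ T) with hD
  have hDC : D ⊆ C := Finset.filter_subset _ _
  -- Over an edge containing C without `v`, the fibre of D is D and its toggle at `v`. Their signs
  -- are opposite, so `g` vanishes at the tuple meant to lie in its support.
  obtain ⟨v, hv, hsign⟩ := exists_toggle_negativeCard hC hDC
  obtain ⟨X, hX, hCX⟩ := hsub v hv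
  have hvX : v ∉ X := fun hvX => hcon ⟨X, hX, by
    rw [← Finset.insert_erase hv]; exact Finset.insert_subset hvX hCX⟩
  obtain ⟨hne0, E, hEC, hE⟩ := hT ⟨X, hX⟩
  have hTD : indicatorTuple Dom T X = indicatorTuple Dom (D : Set Attr) X := by
    refine indicatorTuple_eq_iff.2 fun A hA => ?_
    rw [hD, Finset.mem_coe, Finset.mem_filter]
    exact ⟨fun h => ⟨hEC ((hE A hA).1 h), h⟩, fun h => h.2⟩
  have hle' : indicatorSum Dom 𝒟₀ X (indicatorTuple Dom T X) ≤
      indicatorSum Dom 𝒟₁ X (indicatorTuple Dom T X) := by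
    refine indicatorSum_apply_le hvX fun E hE hET => ?_
    obtain ⟨hEC, hE⟩ := Finset.mem_filter.1 hE
    rw [Finset.mem_powerset] at hEC
    refine Finset.mem_filter.2 ⟨Finset.mem_powerset.2 (Finset.toggle_subset hv hEC), ?_⟩
    rcases hfiber X v hCX E hEC D hDC (hET.trans hTD) with hED | hED
    · rw [hED] at hE ⊢
      by_contra hcon'
      exact hE (hsign.2 hcon')
    · rw [hED] at hE ⊢
      rw [Finset.toggle_toggle]
      exact hsign.2 hE
  have h1 := DFunLike.congr_fun (hadd ⟨X, hX⟩) (indicatorTuple Dom T X)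
  rw [Finsupp.add_apply] at h1
  exact hne0 (by dsimp only at h1 hle' ⊢; omega)

/-- Cliques with at most two elements lie in an edge by adjacency; larger ones by induction on their
proper subsets. -/
theorem LocalToGlobal.isConformal [Nontrivial K] (hK : IsPositiveMonoid K)
    (h : LocalToGlobal K Dom H) : IsConformal H.edges := by
  intro C
  induction C using Finset.strongInduction with
  | H C ih =>
    intro hC hclique
    by_cases h3 : 3 ≤ C.card
    · refine h.exists_edge_of_erase hK h3 fun v hv => ih _ (Finset.erase_ssubset hv) ?_ ?_
      · have := Finset.card_erase_add_one hv
        exact Finset.card_pos.1 (by omega)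
      · exact fun x hx y hy => hclique x (Finset.mem_of_mem_erase hx) y (Finset.mem_of_mem_erase hy)
    · have hpos := Finset.card_pos.2 hC
      obtain h1 | h2 : C.card = 1 ∨ C.card = 2 := by omega
      · obtain ⟨x, rfl⟩ := Finset.card_eq_one.1 h1
        obtain ⟨X, hX, hx, -⟩ := hclique x (by simp) x (by simp)
        exact ⟨X, hX, by simpa using hx⟩
      · obtain ⟨x, y, -, rfl⟩ := Finset.card_eq_two.1 h2
        obtain ⟨X, hX, hx, hy⟩ := hclique x (by simp) y (by simp)
        exact ⟨X, hX, by simp [Finset.insert_subset_iff, hx, hy]⟩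

/-- Over a nontrivial positive monoid, only acyclic hypergraphs have the local-to-global
consistency property. -/
theorem LocalToGlobal.acyclic [Nontrivial K] (hK : IsPositiveMonoid K)
    (h : LocalToGlobal K Dom H) : H.Acyclic :=
  (h.isConformal hK).acyclic (h.noChordlessCycle hK)

end IndicatorSum

theorem theorem7 {Attr : Type u} [DecidableEq Attr] [Nontrivial Attr] :
    ∃ prog : ∀ H : AttrHypergraph Attr, SemijoinProgram H,
      ∀ (Dom : Attr → Type v) [∀ A, Nontrivial (Dom A)]
        (K : Type w) [AddCommMonoid K] [Nontrivial K],
        IsPositiveMonoid K → InnerConsistencyProperty K Dom →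
        ∀ H : AttrHypergraph Attr,
          List.TFAE [
            H.Acyclic,
            ∀ S : SemijoinFunction K Dom, IsFullReducer (prog H) S,
            ∃ π : SemijoinProgram H, ∀ S : SemijoinFunction K Dom, IsFullReducer π S,
            HasFullReducer K Dom H] := by
  classical
  -- The program is chosen before the domains and the monoid. For cyclic H the value `[]` is
  -- immaterial, since all four statements fail.
  refine ⟨fun H => if h : H.Acyclic then h.exists_isFullReducer.{u, v, w}.choose else [],
    fun Dom _ K _ _ hK hI H => ?_⟩
  tfae_have 1 → 2 := fun h S => by
    simp only [dif_pos h]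
    exact h.exists_isFullReducer.choose_spec Dom K hK hI S
  tfae_have 2 → 3 := fun h => ⟨_, h⟩
  tfae_have 3 → 4 := fun ⟨π, h⟩ =>
    let ⟨S⟩ := hI.nonempty_semijoinFunction hK
    ⟨π, S, h S⟩
  tfae_have 4 → 1 := fun h => (h.localToGlobal hI).acyclic hK
  tfae_finish
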